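/- Let $(E,E_+,\Vert\cdot\Vert)$ be a normed ordered space, i.e. a real normed space with a cone $E_+$ (closed under sums and multiplication by non-negative scalars, with $E_+\cap(-E_+)=\{0\}$), ordered by $x\le y\iff y-x\in E_+$, and assume that $E_+$ is closed. Write $E'$ for the topological dual of $E$ with the dual norm, $E'_+$ for the set of positive functionals in $E'$ (those with $f(x)\ge 0$ for all $x\in E_+$), and $E'_{+,1}=\{f\in E'_+ : \Vert f\Vert\le 1\}$. An isometric isomorphism of $E$ onto a subspace $W$ of an ordered space $F$ endowed with a norm is a linear bijection $\phi\colon E\to W$ with $\Vert\phi(x)\Vert=\Vert x\Vert$ and $x\ge 0\iff\phi(x)\ge 0$ for all $x\in E$. For $X$ compact Hausdorff, $C(X)$ is the space of continuous real functions on $X$ with the pointwise order and the supremum norm. The following are equivalent. 1. There are a compact Hausdorff space $X$ and an isometric isomorphism $\phi$ of $E$ onto a subspace $W\subseteq C(X)$ such that every $f\in E'_+$ has a positive continuous extension $\tilde f\in C(X)'_+$ (i.e. $\tilde f\circ\phi=f$) with $\Vert\tilde f\Vert=\Vert f\Vert$. 2. There are a compact Hausdorff space $X$ and an isometric isomorphism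 $\phi$ of $E$ onto a subspace $W\subseteq C(X)$ such that for every $f\in E'_{+,1}$ there is $x_f\in X$ with $\phi(u)(x_f)=f(u)$ for all $u\in E$. 3. There are a compact Hausdorff space $X$ and a subspace $W\subseteq C(X)$ isometrically isomorphic to $E$. 4. The unit ball of $E$ is full: if $a\le x\le b$ and $\Vert a\Vert,\Vert b\Vert\le 1$, then $\Vert x\Vert\le 1$. 5. Every $x\in E$ is semi-positive ($\Vert x+l\Vert\ge\Vert x\Vert$ for all $l\in E_+$) or semi-negative ($\Vert x-l\Vert\ge\Vert x\Vert$ for all $l\in E_+$). 6. If $x\le y\le z$ in $E$, then $\Vert y\Vert\le\max\{\Vert x\Vert,\Vert z\Vert\}$. 7. For every $u\in E'$ there are $v_1,v_2\in E'_+$ with $u=v_1-v_2$ and $\Vert u\Vert=\Vert v_1\Vert+\Vert v_2\Vert$. 8. For every $x_0\in E$ there is $f\in E'_{+,1}$, with $\Vert f\Vert=1$ (a state) if $E\neq\{0\}$, such that $|f(x_0)|=\Vert x_0\Vert$. 9. For every $x_0\in E$, $\sup_{f\in E'_{+,1}}|f(x_0)|=\Vert x_0\Vert$. 10. There are a (not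 necessarily unital, complex) $C^*$-algebra $\mathcal A$ and a real subspace $W$ of the space $\mathcal A^h$ of its Hermitian elements, ordered by the cone $\{a^*a : a\in\mathcal A\}$, such that $E$ is isometrically isomorphic to $W$. 11. The same as 10 with $\mathcal A$ commutative. 12. There are a Riesz space $R$ with an M-norm (a norm with $\Vert\,|x|\,\Vert=\Vert x\Vert$ for all $x\in R$ and $\Vert x\vee y\Vert=\max\{\Vert x\Vert,\Vert y\Vert\}$ for all $x,y\ge 0$) and a subspace $P\subseteq R$ isometrically isomorphic to $E$. 13. There are an almost Archimedean ordered space $F$ (if $-\lambda x\le y\le\lambda x$ for all $\lambda>0$, then $y=0$) with an order unit $e$ (for every $x\in F$ there is $\lambda>0$ with $x\le\lambda e$), normed by $\Vert x\Vert_e=\inf\{\lambda>0 : -\lambda e\le x\le\lambda e\}$, and a subspace $K\subseteq F$ isometrically isomorphic to $E$. 14. There are an Archimedean ordered space $F$ (if $x\ge 0$ and $y+\lambda x\ge 0$ for all $\lambda>0$, then $y\ge 0$) with an order unit $e$, normed by $\Vert\cdot\Vert_e$ as in 13, and a subspace $K\subseteq F$ isometrically isomorphic to $E$. -/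

import Mathlib

namespace OrdRep

/-- The set `E'₊` of positive continuous linear functionals on `E`. -/
def positiveDual (E : Type*) [NormedAddCommGroup E] [NormedSpace ℝ E] [PartialOrder E] :
    Set (StrongDual ℝ E) :=
  {f | ∀ x : E, 0 ≤ x → 0 ≤ f x}

/-- The set `E'₊,₁` of positive continuous linear functionals of norm at most one. -/
def positiveDualBall (E : Type*) [NormedAddCommGroup E] [NormedSpace ℝ E] [PartialOrder E] :
    Set (StrongDual ℝ E) :=
  {f | f ∈ positiveDual E ∧ ‖f‖ ≤ 1}

/-- The linear bijection `φ` of `E` onto the subspace `W` of `F` is an isometric isomorphism: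
it is bipositive and isometric, where `F` carries the cone `C` and the norm `N`, and `W` carries
their restrictions. -/
structure IsIsometricIsomorphism {E F : Type*} [NormedAddCommGroup E] [NormedSpace ℝ E]
    [PartialOrder E] [AddCommGroup F] [Module ℝ F] (C : Set F) (N : F → ℝ)
    (W : Submodule ℝ F) (φ : E ≃ₗ[ℝ] W) : Prop where
  bipositive : ∀ x : E, 0 ≤ x ↔ (φ x : F) ∈ C
  isometric : ∀ x : E, N (φ x : F) = ‖x‖

/-- `φ` is an isometric isomorphism of `E` onto the subspace `W` of `C(X)`, where `C(X)` carries
the pointwise order and the supremum norm. -/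
def IsIsometricIsomorphismCX {E X : Type*} [NormedAddCommGroup E] [NormedSpace ℝ E]
    [PartialOrder E] [TopologicalSpace X] [CompactSpace X]
    (W : Submodule ℝ C(X, ℝ)) (φ : E ≃ₗ[ℝ] W) : Prop :=
  IsIsometricIsomorphism {g : C(X, ℝ) | 0 ≤ g} (fun g => ‖g‖) W φ

/-- `x` is semi-positive. -/
def SemiPositive {E : Type*} [NormedAddCommGroup E] [PartialOrder E] (x : E) : Prop :=
  ∀ l : E, 0 ≤ l → ‖x‖ ≤ ‖x + l‖

/-- `x` is semi-negative. -/
def SemiNegative {E : Type*} [NormedAddCommGroup E] [PartialOrder E] (x : E) : Prop :=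
  ∀ l : E, 0 ≤ l → ‖x‖ ≤ ‖x - l‖

/-- The cone `{b⋆ b}` of positive elements, inside the real vector space of Hermitian elements
of a (possibly non-unital) C⋆-algebra. -/
def hermitianCone (A : Type*) [NonUnitalCStarAlgebra A] : Set (selfAdjoint A) :=
  {a | ∃ b : A, (a : A) = star b * b}

/-- The norm of the normed Riesz space `R` is an M-norm: it is a Riesz norm and takes suprema of
positive elements to maxima. -/
structure IsMNorm (R : Type*) [NormedAddCommGroup R] [Lattice R] : Prop where
  norm_abs_eq : ∀ x : R, ‖|x|‖ = ‖x‖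
  norm_sup_eq : ∀ x y : R, 0 ≤ x → 0 ≤ y → ‖x ⊔ y‖ = max ‖x‖ ‖y‖

section OrderUnit

variable {F : Type*} [AddCommGroup F] [Module ℝ F] [PartialOrder F]

/-- `e` is an order unit. -/
def IsOrderUnit (e : F) : Prop :=
  ∀ x : F, ∃ t : ℝ, 0 < t ∧ x ≤ t • e

/-- The order (semi)norm associated to an order unit `e`. -/
noncomputable def orderNorm (e x : F) : ℝ :=
  sInf {t : ℝ | 0 < t ∧ -(t • e) ≤ x ∧ x ≤ t • e}

/-- `F` is Archimedean as an ordered vector space. -/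
def IsArchimedeanSpace (F : Type*) [AddCommGroup F] [Module ℝ F] [PartialOrder F] : Prop :=
  ∀ x y : F, 0 ≤ x → (∀ t : ℝ, 0 < t → 0 ≤ y + t • x) → 0 ≤ y

/-- `F` is almost Archimedean as an ordered vector space. -/
def IsAlmostArchimedeanSpace (F : Type*) [AddCommGroup F] [Module ℝ F] [PartialOrder F] : Prop :=
  ∀ x y : F, (∀ t : ℝ, 0 < t → -(t • x) ≤ y ∧ y ≤ t • x) → y = 0

end OrderUnit

end OrdRep

universe u v

open OrdRep

/-! The inequality `‖y‖ ≤ max ‖x‖ ‖z‖` for `x ≤ y ≤ z` is the hub. It holds in every concrete model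
(`C(X)`, M-normed Riesz spaces, order unit spaces, Hermitian parts of C⋆-algebras) and passes to
subspaces.

The hard direction recovers a representation from it. By Hahn–Banach on `E × E`
(`exists_sub_norm_add`), the functional `(x, -x) ↦ u x` on the antidiagonal extends under the bound
`‖u‖ * dominatingGauge`. On `(x, -x)` the gauge measures pairs with `-b ≤ x ≤ a`, so the hub
inequality is what gives the bound there. The components of the extension give `u = v₁ - v₂`. The
gauge is nonpositive on pairs of nonpositive vectors, so both parts are positive; it is at most the
max norm, whose dual is the sum norm, so the norms add up.

Splitting a norming functional of `x` this way forces each part to norm `x` up to scaling, which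
yields a state. Evaluation on the weak-* compact set of positive contractive functionals is then
isometric, and it is bipositive because a closed cone is cut out by such functionals. Finally,
`C(X)` is itself an instance of each of the other models. -/

namespace OrdRep

/-! ### A sublinear functional on `E × E` mixing norm and order. -/

section DominatingGauge

variable {E : Type*} [NormedAddCommGroup E] [PartialOrder E]

/-- The values `r` such that both components of `w` are dominated by elements of norm at
most `r`. -/
def dominatingRadii (w : E × E) : Set ℝ :=
  {r | ∃ a b : E, w.1 ≤ a ∧ w.2 ≤ b ∧ ‖a‖ ≤ r ∧ ‖b‖ ≤ r}

/-- The sublinear functional `w ↦ inf {max ‖a‖ ‖b‖ : w.1 ≤ a, w.2 ≤ b}` on `E × E`. -/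
noncomputable def dominatingGauge (w : E × E) : ℝ := sInf (dominatingRadii w)

theorem mem_dominatingRadii (w : E × E) : max ‖w.1‖ ‖w.2‖ ∈ dominatingRadii w :=
  ⟨w.1, w.2, le_rfl, le_rfl, le_max_left _ _, le_max_right _ _⟩

theorem nonneg_of_mem_dominatingRadii {w : E × E} {r : ℝ} (h : r ∈ dominatingRadii w) :
    0 ≤ r := by
  obtain ⟨a, -, -, -, h, -⟩ := h
  exact (norm_nonneg a).trans h

theorem bddBelow_dominatingRadii (w : E × E) : BddBelow (dominatingRadii w) :=
  ⟨0, fun _ h => nonneg_of_mem_dominatingRadii h⟩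

theorem dominatingGauge_le {w : E × E} {r : ℝ} (h : r ∈ dominatingRadii w) :
    dominatingGauge w ≤ r :=
  csInf_le (bddBelow_dominatingRadii w) h

theorem dominatingGauge_add_le [IsOrderedAddMonoid E] (w z : E × E) :
    dominatingGauge (w + z) ≤ dominatingGauge w + dominatingGauge z := by
  refine le_of_forall_pos_lt_add fun ε hε => ?_
  obtain ⟨r, ⟨a, b, h1, h2, h3, h4⟩, hr⟩ :=
    exists_lt_of_csInf_lt ⟨_, mem_dominatingRadii w⟩ (lt_add_of_pos_right _ (half_pos hε))
  obtain ⟨s, ⟨c, d, k1, k2, k3, k4⟩, hs⟩ :=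
    exists_lt_of_csInf_lt ⟨_, mem_dominatingRadii z⟩ (lt_add_of_pos_right _ (half_pos hε))
  have : dominatingGauge (w + z) ≤ r + s :=
    dominatingGauge_le ⟨a + c, b + d, add_le_add h1 k1, add_le_add h2 k2,
      (norm_add_le _ _).trans (add_le_add h3 k3), (norm_add_le _ _).trans (add_le_add h4 k4)⟩
  unfold dominatingGauge at this ⊢
  linarith

theorem dominatingGauge_smul_le [NormedSpace ℝ E] [IsOrderedModule ℝ E] {c : ℝ} (hc : 0 < c) (w : E × E) :
    dominatingGauge (c • w) ≤ c * dominatingGauge w := by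
  rw [← div_le_iff₀' hc]
  refine le_csInf ⟨_, mem_dominatingRadii w⟩ fun r hr => ?_
  rw [div_le_iff₀' hc]
  obtain ⟨a, b, h1, h2, h3, h4⟩ := hr
  refine dominatingGauge_le ⟨c • a, c • b, smul_le_smul_of_nonneg_left h1 hc.le,
    smul_le_smul_of_nonneg_left h2 hc.le, ?_, ?_⟩ <;>
  · rw [norm_smul, Real.norm_of_nonneg hc.le]
    gcongr

theorem dominatingGauge_smul [NormedSpace ℝ E] [IsOrderedModule ℝ E] {c : ℝ} (hc : 0 < c) (w : E × E) :
    dominatingGauge (c • w) = c * dominatingGauge w := by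
  refine (dominatingGauge_smul_le hc w).antisymm ?_
  have := dominatingGauge_smul_le (inv_pos.2 hc) (c • w)
  rwa [inv_smul_smul₀ hc.ne', inv_mul_eq_div, le_div_iff₀' hc] at this

end DominatingGauge

/-! ### Positive functionals: decomposition, norming states, separation. -/

section Functionals

variable {E : Type*} [NormedAddCommGroup E] [NormedSpace ℝ E]

/-- Replacing `x` by `-x` makes a one-sided bound enough. The sign of `M` is not assumed, so a
difference of norms can serve as the bound. -/
theorem opNorm_le_of_forall_le {f : StrongDual ℝ E} {M : ℝ}
    (h : ∀ x, ‖x‖ ≤ 1 → f x ≤ M) : ‖f‖ ≤ M := by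
  have hM : 0 ≤ M := by simpa using h 0 (by simp)
  refine ContinuousLinearMap.opNorm_le_of_unit_norm hM fun x hx => ?_
  rw [Real.norm_eq_abs]
  refine abs_le'.2 ⟨h x hx.le, ?_⟩
  simpa using h (-x) (by simp [hx])

theorem norm_inv_norm_smul {f : StrongDual ℝ E} (hf : f ≠ 0) : ‖‖f‖⁻¹ • f‖ = 1 := by
  rw [norm_smul, norm_inv, norm_norm, inv_mul_cancel₀ (norm_ne_zero_iff.2 hf)]

variable [PartialOrder E]

/-- In a space with full unit ball, every continuous functional is a difference of positive
functionals whose norms add up. -/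
theorem exists_sub_norm_add [IsOrderedAddMonoid E] [IsOrderedModule ℝ E]
    (h : ∀ x y z : E, x ≤ y → y ≤ z → ‖y‖ ≤ max ‖x‖ ‖z‖) (u : StrongDual ℝ E) :
    ∃ v₁ ∈ positiveDual E, ∃ v₂ ∈ positiveDual E, u = v₁ - v₂ ∧ ‖u‖ = ‖v₁‖ + ‖v₂‖ := by
  let antidiag : E →ₗ[ℝ] E × E := LinearMap.prod LinearMap.id (-LinearMap.id)
  let f : E × E →ₗ.[ℝ] ℝ :=
    ⟨LinearMap.range antidiag, u.toLinearMap ∘ₗ LinearMap.fst ℝ E E ∘ₗ Submodule.subtype _⟩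
  obtain ⟨g, hgf, hg⟩ := exists_extension_of_le_sublinear f (fun w => ‖u‖ * dominatingGauge w)
    (fun c hc w => by rw [dominatingGauge_smul hc]; ring)
    (fun w z => by
      rw [← mul_add]
      exact mul_le_mul_of_nonneg_left (dominatingGauge_add_le w z) (norm_nonneg u))
    (by
      rintro ⟨_, x, rfl⟩
      have hux : u x ≤ ‖u‖ * ‖x‖ := (le_abs_self _).trans (u.le_opNorm x)
      refine hux.trans (mul_le_mul_of_nonneg_left ?_ (norm_nonneg u))
      refine le_csInf ⟨_, mem_dominatingRadii _⟩ ?_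
      rintro r ⟨a, b, h1, h2, h3, h4⟩
      -- Now `-b ≤ x ≤ a`, and the hub inequality bounds `‖x‖` by `max ‖b‖ ‖a‖`.
      have h2' : -b ≤ x := neg_le.1 h2
      exact (h _ _ _ h2' h1).trans (max_le (by rwa [norm_neg]) h3))
  have hgnorm : ∀ w : E × E, g w ≤ ‖u‖ * max ‖w.1‖ ‖w.2‖ := fun w =>
    (hg w).trans (mul_le_mul_of_nonneg_left (dominatingGauge_le (mem_dominatingRadii w))
      (norm_nonneg u))
  have hgneg : ∀ w : E × E, w.1 ≤ 0 → w.2 ≤ 0 → g w ≤ 0 := fun w h1 h2 =>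
    (hg w).trans (mul_nonpos_of_nonneg_of_nonpos (norm_nonneg u)
      (dominatingGauge_le ⟨0, 0, h1, h2, by simp, by simp⟩))
  let v₁ : StrongDual ℝ E := (g ∘ₗ LinearMap.inl ℝ E E).mkContinuous ‖u‖ fun x => by
    refine abs_le'.2 ⟨by simpa using hgnorm (x, 0), ?_⟩
    rw [← map_neg]
    simpa using hgnorm (-x, 0)
  let v₂ : StrongDual ℝ E := (g ∘ₗ LinearMap.inr ℝ E E).mkContinuous ‖u‖ fun x => by
    refine abs_le'.2 ⟨by simpa using hgnorm (0, x), ?_⟩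
    rw [← map_neg]
    simpa using hgnorm (0, -x)
  have hv₁ : ∀ x, v₁ x = g (x, 0) := fun x => rfl
  have hv₂ : ∀ x, v₂ x = g (0, x) := fun x => rfl
  have hsum : ∀ x y, v₁ x + v₂ y = g (x, y) := fun x y => by
    rw [hv₁, hv₂, ← map_add]; simp
  have hu : u = v₁ - v₂ := by
    ext x
    have h1 : g (x, -x) = u x := hgf ⟨(x, -x), x, rfl⟩
    rw [← h1, ← hsum, map_neg, sub_apply, sub_eq_add_neg]
  refine ⟨v₁, fun x hx => ?_, v₂, fun x hx => ?_, hu, le_antisymm ?_ ?_⟩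
  · have := hgneg (-x, 0) (by simpa using hx) le_rfl
    rw [← hv₁, map_neg] at this
    linarith
  · have := hgneg (0, -x) le_rfl (by simpa using hx)
    rw [← hv₂, map_neg] at this
    linarith
  · rw [hu]; exact norm_sub_le _ _
  -- Suprema over `x` and `y` in the unit ball are taken independently: `(x, y)` then has max norm
  -- at most one, so `g (x, y) ≤ ‖u‖`.
  · rw [← le_sub_iff_add_le]
    refine opNorm_le_of_forall_le fun x hx => ?_
    rw [le_sub_comm]
    refine opNorm_le_of_forall_le fun y hy => ?_
    rw [le_sub_iff_add_le', hsum]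
    exact (hgnorm _).trans (mul_le_of_le_one_right (norm_nonneg u) (max_le hx hy))

/-- For `f = 0` the convention `0⁻¹ = 0` yields the zero functional, so no case split is needed. -/
theorem inv_norm_smul_mem_positiveDualBall {f : StrongDual ℝ E} (hf : f ∈ positiveDual E) :
    ‖f‖⁻¹ • f ∈ positiveDualBall E := by
  refine ⟨fun x hx => mul_nonneg (inv_nonneg.2 (norm_nonneg f)) (hf x hx), ?_⟩
  rw [norm_smul, norm_inv, norm_norm]
  exact inv_mul_le_one

/-- A norm-additive decomposition of functionals yields norming states, at nonzero vectors. -/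
theorem exists_state_of_ne_zero
    (h : ∀ u : StrongDual ℝ E, ∃ v₁ ∈ positiveDual E, ∃ v₂ ∈ positiveDual E,
      u = v₁ - v₂ ∧ ‖u‖ = ‖v₁‖ + ‖v₂‖) {x : E} (hx : x ≠ 0) :
    ∃ f ∈ positiveDualBall E, ‖f‖ = 1 ∧ |f x| = ‖x‖ := by
  obtain ⟨u, hu, hux⟩ := exists_dual_vector ℝ x (norm_ne_zero_iff.2 hx)
  obtain ⟨v₁, hv₁, v₂, hv₂, rfl, hnorm⟩ := h u
  have key : ∀ v ∈ positiveDual E, v ≠ 0 → ‖v‖ * ‖x‖ ≤ |v x| →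
      ∃ f ∈ positiveDualBall E, ‖f‖ = 1 ∧ |f x| = ‖x‖ := fun v hv hv0 hvx => by
    have hpos : 0 < ‖v‖ := norm_pos_iff.2 hv0
    refine ⟨_, inv_norm_smul_mem_positiveDualBall hv, norm_inv_norm_smul hv0, ?_⟩
    have hle : |v x| = ‖v‖ * ‖x‖ := le_antisymm (v.le_opNorm x) hvx
    rw [smul_apply, smul_eq_mul, abs_mul, abs_inv, abs_norm, hle,
      inv_mul_cancel_left₀ hpos.ne']
  have h1 : |v₁ x| ≤ ‖v₁‖ * ‖x‖ := v₁.le_opNorm x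
  have h2 : |v₂ x| ≤ ‖v₂‖ * ‖x‖ := v₂.le_opNorm x
  have h3 : ‖x‖ ≤ |v₁ x| + |v₂ x| := by
    have : (v₁ - v₂) x = ‖x‖ := hux
    rw [← this, sub_apply]
    exact (le_abs_self _).trans (abs_sub _ _)
  -- With `h3`, this forces equality in both `h1` and `h2`; either part that is nonzero can be
  -- normalized to a state.
  have h4 : ‖x‖ = ‖v₁‖ * ‖x‖ + ‖v₂‖ * ‖x‖ := by rw [← add_mul, ← hnorm, hu, one_mul]
  by_cases h0 : v₁ = 0
  · have h0' : v₂ ≠ 0 := by rintro rfl; simp [h0] at hu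
    exact key v₂ hv₂ h0' (by linarith)
  · exact key v₁ hv₁ h0 (by linarith)

theorem zero_mem_positiveDualBall : (0 : StrongDual ℝ E) ∈ positiveDualBall E :=
  ⟨fun _ _ => le_rfl, by simp⟩

theorem exists_state
    (h : ∀ u : StrongDual ℝ E, ∃ v₁ ∈ positiveDual E, ∃ v₂ ∈ positiveDual E,
      u = v₁ - v₂ ∧ ‖u‖ = ‖v₁‖ + ‖v₂‖) (x : E) :
    ∃ f ∈ positiveDualBall E, (Nontrivial E → ‖f‖ = 1) ∧ |f x| = ‖x‖ := by
  rcases eq_or_ne x 0 with rfl | hx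
  · by_cases hE : Nontrivial E
    -- At `x = 0` any state will do, so one is taken that norms some nonzero vector.
    · obtain ⟨y, hy⟩ := exists_ne (0 : E)
      obtain ⟨f, hf, hf1, -⟩ := exists_state_of_ne_zero h hy
      exact ⟨f, hf, fun _ => hf1, by simp⟩
    · exact ⟨0, zero_mem_positiveDualBall, fun h => (hE h).elim, by simp⟩
  · obtain ⟨f, hf, hf1, hfx⟩ := exists_state_of_ne_zero h hx
    exact ⟨f, hf, fun _ => hf1, hfx⟩

theorem abs_apply_le_norm {f : StrongDual ℝ E} (hf : f ∈ positiveDualBall E) (x : E) :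
    |f x| ≤ ‖x‖ :=
  f.le_of_opNorm_le hf.2 x |>.trans_eq (one_mul _)

/-- A closed cone is determined by the positive contractive functionals. -/
theorem nonneg_iff_forall_positiveDualBall [IsOrderedAddMonoid E] [IsOrderedModule ℝ E]
    (hclosed : IsClosed {x : E | 0 ≤ x}) (x : E) :
    0 ≤ x ↔ ∀ f ∈ positiveDualBall E, 0 ≤ f x := by
  refine ⟨fun hx f hf => hf.1 x hx, fun h => ?_⟩
  by_contra hx
  let C : ProperCone ℝ E := ⟨PointedCone.positive ℝ E, hclosed⟩
  obtain ⟨f, hf, hfx⟩ := C.hyperplane_separation_point (x₀ := x) hx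
  have hf0 : f ≠ 0 := by rintro rfl; simp at hfx
  have := h _ (inv_norm_smul_mem_positiveDualBall (f := f) fun y hy => hf y hy)
  rw [smul_apply, smul_eq_mul] at this
  exact absurd this (not_le.2 (mul_neg_of_pos_of_neg (inv_pos.2 (norm_pos_iff.2 hf0)) hfx))

end Functionals

/-! ### Representation on the weak-* compact set of positive contractions. -/

section Representation

variable {E : Type u} [NormedAddCommGroup E] [NormedSpace ℝ E] [PartialOrder E]

/-- A bipositive and isometric linear map is an isometric isomorphism onto its range. -/
theorem exists_isIsometricIsomorphism_of_linearMap [IsOrderedAddMonoid E] {F : Type*}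
    [AddCommGroup F] [Module ℝ F] {C : Set F} {N : F → ℝ} (ψ : E →ₗ[ℝ] F)
    (hC : ∀ x, 0 ≤ x ↔ ψ x ∈ C) (hN : ∀ x, N (ψ x) = ‖x‖) :
    ∃ (W : Submodule ℝ F) (φ : E ≃ₗ[ℝ] W), (∀ x, (φ x : F) = ψ x) ∧
      IsIsometricIsomorphism C N W φ := by
  have h0 : (0 : F) ∈ C := by simpa using (hC 0).1 le_rfl
  have hinj : Function.Injective ψ := (injective_iff_map_eq_zero ψ).2 fun x hx => by
    refine le_antisymm (neg_nonneg.1 ((hC _).2 ?_)) ((hC _).2 ?_)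
    · rwa [map_neg, hx, neg_zero]
    · rwa [hx]
  exact ⟨LinearMap.range ψ, LinearEquiv.ofInjective ψ hinj, fun x => rfl,
    fun x => hC x, fun x => hN x⟩

/-- An isometric isomorphism onto a subspace of `F`, followed by a bipositive and isometric linear
map `F → G`. -/
theorem IsIsometricIsomorphism.exists_comp [IsOrderedAddMonoid E] {F G : Type*}
    [AddCommGroup F] [Module ℝ F] [AddCommGroup G] [Module ℝ G] {C : Set F} {N : F → ℝ}
    {W : Submodule ℝ F} {φ : E ≃ₗ[ℝ] W} (hφ : IsIsometricIsomorphism C N W φ)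
    {D : Set G} {M : G → ℝ} (ψ : F →ₗ[ℝ] G)
    (hD : ∀ x, x ∈ C ↔ ψ x ∈ D) (hM : ∀ x, M (ψ x) = N x) :
    ∃ (V : Submodule ℝ G) (χ : E ≃ₗ[ℝ] V), IsIsometricIsomorphism D M V χ := by
  obtain ⟨V, χ, -, h⟩ := exists_isIsometricIsomorphism_of_linearMap (C := D) (N := M)
    (ψ ∘ₗ W.subtype ∘ₗ φ.toLinearMap)
    (fun x => (hφ.bipositive x).trans (hD _)) (fun x => (hM _).trans (hφ.isometric x))
  exact ⟨V, χ, h⟩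

theorem isCompact_positiveDualBall :
    IsCompact (WeakDual.toStrongDual ⁻¹' positiveDualBall E : Set (WeakDual ℝ E)) := by
  have hball := WeakDual.isCompact_closedBall (𝕜 := ℝ) (E := E) 0 1
  have hpos : IsClosed {f : WeakDual ℝ E | ∀ x : E, 0 ≤ x → 0 ≤ f x} := by
    simp only [Set.ofPred_forall]
    exact isClosed_iInter fun x => isClosed_iInter fun _ =>
      isClosed_le continuous_const (WeakDual.eval_continuous x)
  convert hball.inter_left hpos using 1
  ext f
  simp [positiveDualBall, positiveDual]

/-- If the norm is determined by the positive contractive functionals, then `E` is represented on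
the weak-* compact space of these functionals. -/
theorem exists_representation_of_isLUB [IsOrderedAddMonoid E] [IsOrderedModule ℝ E]
    (hclosed : IsClosed {x : E | 0 ≤ x})
    (h : ∀ x : E, IsLUB ((fun f : StrongDual ℝ E => |f x|) '' positiveDualBall E) ‖x‖) :
    ∃ (X : Type (max u v)) (_ : TopologicalSpace X) (_ : CompactSpace X) (_ : T2Space X)
      (W : Submodule ℝ C(X, ℝ)) (φ : E ≃ₗ[ℝ] W), IsIsometricIsomorphismCX W φ ∧
      ∀ f ∈ positiveDualBall E, ∃ x : X, ∀ y : E, (φ y : C(X, ℝ)) x = f y := by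
  let S : Set (WeakDual ℝ E) := WeakDual.toStrongDual ⁻¹' positiveDualBall E
  have : CompactSpace S := isCompact_iff_compactSpace.1 isCompact_positiveDualBall
  -- The lift only moves the space to the larger universe.
  let X := ULift.{v} S
  have hX : CompactSpace X := Homeomorph.ulift.symm.compactSpace
  let ψ : E →ₗ[ℝ] C(X, ℝ) :=
    { toFun := fun y => ⟨fun f => f.down.1 y,
        (WeakDual.eval_continuous y).comp (continuous_subtype_val.comp continuous_uliftDown)⟩
      map_add' := fun y z => by ext f; exact map_add f.down.1 y z
      map_smul' := fun c y => by ext f; exact map_smul f.down.1 c y }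
  obtain ⟨W, φ, hφ, hiso⟩ := exists_isIsometricIsomorphism_of_linearMap
    (C := {g : C(X, ℝ) | 0 ≤ g}) (N := fun g => ‖g‖) ψ
    (fun y => (nonneg_iff_forall_positiveDualBall hclosed y).trans
      ⟨fun hy f => hy _ f.down.2, fun hy f hf => hy ⟨⟨f, hf⟩⟩⟩)
    (fun y => le_antisymm
      ((ContinuousMap.norm_le _ (norm_nonneg y)).2 fun f => abs_apply_le_norm f.down.2 y)
      ((h y).2 (by
        rintro _ ⟨f, hf, rfl⟩
        exact (ψ y).norm_coe_le_norm ⟨⟨f, hf⟩⟩)))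
  exact ⟨X, inferInstance, hX, inferInstance, W, φ, hiso, fun f hf =>
    ⟨⟨⟨f, hf⟩⟩, fun y => by rw [hφ]; rfl⟩⟩

/-- Evaluations extend positive functionals with preservation of the norm. -/
theorem exists_positive_extension {X : Type*} [TopologicalSpace X] [CompactSpace X]
    {W : Submodule ℝ C(X, ℝ)} {φ : E ≃ₗ[ℝ] W} (hφ : IsIsometricIsomorphismCX W φ)
    (h : ∀ f ∈ positiveDualBall E, ∃ x : X, ∀ y : E, (φ y : C(X, ℝ)) x = f y)
    {f : StrongDual ℝ E} (hf : f ∈ positiveDual E) :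
    ∃ g ∈ positiveDual C(X, ℝ), (∀ y : E, g (φ y : C(X, ℝ)) = f y) ∧ ‖g‖ = ‖f‖ := by
  obtain ⟨x, hx⟩ := h _ (inv_norm_smul_mem_positiveDualBall hf)
  let g : StrongDual ℝ C(X, ℝ) := ‖f‖ • ContinuousMap.evalCLM ℝ x
  have hg : ∀ k, g k = ‖f‖ * k x := fun k => rfl
  have hgf : ∀ y : E, g (φ y : C(X, ℝ)) = f y := fun y => by
    rw [hg, hx, smul_apply, smul_eq_mul]
    rcases eq_or_ne f 0 with rfl | hf0
    · simp
    · rw [mul_inv_cancel_left₀ (norm_ne_zero_iff.2 hf0)]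
  refine ⟨g, fun k hk => mul_nonneg (norm_nonneg f) (hk x), hgf, le_antisymm ?_ ?_⟩
  · refine g.opNorm_le_bound (norm_nonneg f) fun k => ?_
    rw [hg, norm_mul, norm_norm]
    exact mul_le_mul_of_nonneg_left (k.norm_coe_le_norm x) (norm_nonneg f)
  · refine f.opNorm_le_bound (norm_nonneg g) fun y => ?_
    rw [← hgf, ← hφ.isometric y]
    exact g.le_opNorm _

end Representation

/-! ### Full unit balls and M-norms. -/

section Fullness

variable {E : Type*} [NormedAddCommGroup E] [NormedSpace ℝ E] [PartialOrder E]

theorem norm_le_max_of_full_ball [IsOrderedModule ℝ E]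
    (h : ∀ a x b : E, a ≤ x → x ≤ b → ‖a‖ ≤ 1 → ‖b‖ ≤ 1 → ‖x‖ ≤ 1)
    {x y z : E} (hxy : x ≤ y) (hyz : y ≤ z) : ‖y‖ ≤ max ‖x‖ ‖z‖ := by
  -- Rescaling by some `r` strictly above the maximum avoids dividing by zero when both ends vanish.
  refine le_of_forall_gt_imp_ge_of_dense fun r hr => ?_
  obtain ⟨hx, hz⟩ := max_lt_iff.1 hr
  have hr0 : 0 < r := (norm_nonneg x).trans_lt hx
  have hnorm : ∀ w : E, ‖r⁻¹ • w‖ ≤ 1 ↔ ‖w‖ ≤ r := fun w => by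
    rw [norm_smul, norm_inv, Real.norm_of_nonneg hr0.le, inv_mul_le_one₀ hr0]
  have hr' : 0 ≤ r⁻¹ := (inv_pos.2 hr0).le
  exact (hnorm y).1 (h _ _ _ (smul_le_smul_of_nonneg_left hxy hr')
    (smul_le_smul_of_nonneg_left hyz hr') ((hnorm x).2 hx.le) ((hnorm z).2 hz.le))

/-- The inequality `‖y‖ ≤ max ‖x‖ ‖z‖` for `x ≤ y ≤ z` is inherited along isometric
isomorphisms. -/
theorem IsIsometricIsomorphism.norm_le_max [IsOrderedAddMonoid E] {F : Type*} [AddCommGroup F]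
    [Module ℝ F] {C : Set F} {N : F → ℝ} {W : Submodule ℝ F} {φ : E ≃ₗ[ℝ] W}
    (hφ : IsIsometricIsomorphism C N W φ)
    (h : ∀ x y z : F, y - x ∈ C → z - y ∈ C → N y ≤ max (N x) (N z))
    (x y z : E) (hxy : x ≤ y) (hyz : y ≤ z) : ‖y‖ ≤ max ‖x‖ ‖z‖ := by
  have key : ∀ a b : E, a ≤ b → (φ b : F) - φ a ∈ C := fun a b hab => by
    simpa using (hφ.bipositive (b - a)).1 (sub_nonneg.2 hab)
  simpa only [hφ.isometric] using h _ _ _ (key x y hxy) (key y z hyz)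

theorem IsMNorm.norm_mono {R : Type*} [NormedAddCommGroup R] [Lattice R] (hR : IsMNorm R)
    {a b : R} (ha : 0 ≤ a) (hab : a ≤ b) : ‖a‖ ≤ ‖b‖ := by
  have := hR.norm_sup_eq a b ha (ha.trans hab)
  rw [sup_eq_right.2 hab] at this
  exact this ▸ le_max_left _ _

theorem IsMNorm.norm_le_max {R : Type*} [NormedAddCommGroup R] [Lattice R]
    [IsOrderedAddMonoid R] (hR : IsMNorm R) {x y z : R} (hxy : x ≤ y) (hyz : y ≤ z) :
    ‖y‖ ≤ max ‖x‖ ‖z‖ := by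
  have hle : |y| ≤ |x| ⊔ |z| := abs_le'.2
    ⟨(hyz.trans (le_abs_self z)).trans le_sup_right,
      ((neg_le_neg hxy).trans (neg_le_abs x)).trans le_sup_left⟩
  have := hR.norm_mono (abs_nonneg y) hle
  rwa [hR.norm_sup_eq _ _ (abs_nonneg x) (abs_nonneg z), hR.norm_abs_eq, hR.norm_abs_eq,
    hR.norm_abs_eq] at this

theorem isMNorm_continuousMap (X : Type*) [TopologicalSpace X] [CompactSpace X] :
    IsMNorm C(X, ℝ) where
  norm_abs_eq f := by
    have h : ∀ x, ‖|f| x‖ = ‖f x‖ := fun x => by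
      rw [ContinuousMap.abs_apply, norm_abs_eq_norm]
    refine le_antisymm ?_ ?_ <;> refine (ContinuousMap.norm_le _ (norm_nonneg _)).2 fun x => ?_
    · exact (h x).trans_le (f.norm_coe_le_norm x)
    · exact (h x).symm.trans_le (|f|.norm_coe_le_norm x)
  norm_sup_eq f g hf hg := by
    have hf' : ∀ x, 0 ≤ f x := hf
    have hg' : ∀ x, 0 ≤ g x := hg
    have h : ∀ x, ‖(f ⊔ g) x‖ = max ‖f x‖ ‖g x‖ := fun x => by
      rw [ContinuousMap.sup_apply, Real.norm_of_nonneg (le_max_of_le_left (hf' x)),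
        Real.norm_of_nonneg (hf' x), Real.norm_of_nonneg (hg' x)]
    refine le_antisymm ?_ (max_le ?_ ?_)
    · refine (ContinuousMap.norm_le _ (le_max_of_le_left (norm_nonneg f))).2 fun x => ?_
      exact (h x).trans_le (max_le_max (f.norm_coe_le_norm x) (g.norm_coe_le_norm x))
    · refine (ContinuousMap.norm_le _ (norm_nonneg _)).2 fun x => ?_
      exact ((le_max_left _ _).trans_eq (h x).symm).trans ((f ⊔ g).norm_coe_le_norm x)
    · refine (ContinuousMap.norm_le _ (norm_nonneg _)).2 fun x => ?_
      exact ((le_max_right _ _).trans_eq (h x).symm).trans ((f ⊔ g).norm_coe_le_norm x)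

end Fullness

/-! ### Order unit norms and Archimedean properties. -/

section OrderUnitSpace

variable {F : Type*} [AddCommGroup F] [Module ℝ F] [PartialOrder F] {e : F}

theorem orderNorm_le {x : F} {r : ℝ} (hr : 0 < r) (h1 : -(r • e) ≤ x) (h2 : x ≤ r • e) :
    orderNorm e x ≤ r :=
  csInf_le ⟨0, fun _ ht => ht.1.le⟩ ⟨hr, h1, h2⟩

theorem orderNorm_nonneg (x : F) : 0 ≤ orderNorm e x :=
  Real.sInf_nonneg fun _ ht => ht.1.le

variable [IsOrderedAddMonoid F] [IsOrderedModule ℝ F]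

theorem IsOrderUnit.nonneg (he : IsOrderUnit e) : 0 ≤ e := by
  obtain ⟨t, ht, h⟩ := he (-e)
  have h' : (0 : F) ≤ (1 + t) • e := by
    rw [add_smul, one_smul]; exact neg_le_iff_add_nonneg'.1 h
  have ht' : 0 < 1 + t := by linarith
  simpa [inv_smul_smul₀ ht'.ne'] using smul_nonneg (inv_pos.2 ht').le h'

/-- Strictness matters: without the Archimedean property the infimum need not be attained. -/
theorem IsOrderUnit.mem_interval_of_orderNorm_lt (he : IsOrderUnit e) {x : F} {r : ℝ}
    (h : orderNorm e x < r) : -(r • e) ≤ x ∧ x ≤ r • e := by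
  have hne : {t : ℝ | 0 < t ∧ -(t • e) ≤ x ∧ x ≤ t • e}.Nonempty := by
    obtain ⟨s, hs, hxs⟩ := he x
    obtain ⟨t, ht, hxt⟩ := he (-x)
    have h0 := he.nonneg
    have h1 : s • e ≤ max s t • e := smul_le_smul_of_nonneg_right (le_max_left s t) h0
    have h2 : t • e ≤ max s t • e := smul_le_smul_of_nonneg_right (le_max_right s t) h0
    exact ⟨max s t, lt_max_of_lt_left hs, neg_le.1 (hxt.trans h2), hxs.trans h1⟩
  obtain ⟨t, ⟨-, h1, h2⟩, htr⟩ := exists_lt_of_csInf_lt hne h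
  have h3 : t • e ≤ r • e := smul_le_smul_of_nonneg_right htr.le he.nonneg
  exact ⟨(neg_le_neg h3).trans h1, h2.trans h3⟩

theorem IsOrderUnit.orderNorm_le_max (he : IsOrderUnit e) {x y z : F} (hxy : x ≤ y)
    (hyz : y ≤ z) : orderNorm e y ≤ max (orderNorm e x) (orderNorm e z) := by
  refine le_of_forall_gt_imp_ge_of_dense fun r hr => ?_
  obtain ⟨hx, hz⟩ := max_lt_iff.1 hr
  exact orderNorm_le ((orderNorm_nonneg x).trans_lt hx)
    ((he.mem_interval_of_orderNorm_lt hx).1.trans hxy)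
    (hyz.trans (he.mem_interval_of_orderNorm_lt hz).2)

theorem IsArchimedeanSpace.isAlmostArchimedeanSpace (hF : IsArchimedeanSpace F) :
    IsAlmostArchimedeanSpace F := fun x y h => by
  -- At `t = 1`, `-x ≤ y ≤ x` gives `0 ≤ 2x`; the Archimedean property needs this sign.
  have hx : 0 ≤ x := by
    have h2 : (0 : F) ≤ (2 : ℝ) • x := by
      have := (h 1 one_pos).1.trans (h 1 one_pos).2
      rw [one_smul] at this
      rw [two_smul]
      exact neg_le_iff_add_nonneg.1 this
    simpa using smul_nonneg (by norm_num : (0 : ℝ) ≤ 2⁻¹) h2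
  refine le_antisymm (neg_nonneg.1 (hF x _ hx fun t ht => ?_)) (hF x _ hx fun t ht => ?_)
  · rw [neg_add_eq_sub]; exact sub_nonneg.2 (h t ht).2
  · exact neg_le_iff_add_nonneg.1 (h t ht).1

variable (X : Type*) [TopologicalSpace X]

theorem isArchimedeanSpace_continuousMap : IsArchimedeanSpace C(X, ℝ) := fun f g _ h x => by
  have hlim : Filter.Tendsto (fun t : ℝ => g x + t * f x) (nhdsWithin 0 (Set.Ioi 0))
      (nhds (g x)) := by
    have : Continuous fun t : ℝ => g x + t * f x := by fun_prop
    simpa using (this.tendsto 0).mono_left nhdsWithin_le_nhds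
  exact ge_of_tendsto hlim (eventually_mem_nhdsWithin.mono fun t ht => h t ht x)

variable [CompactSpace X]

theorem isOrderUnit_one_continuousMap : IsOrderUnit (1 : C(X, ℝ)) := fun f =>
  ⟨‖f‖ + 1, by positivity, fun x => by
    have := (le_abs_self _).trans (f.norm_coe_le_norm x)
    have h1 : f x ≤ (‖f‖ + 1) * 1 := by linarith
    exact h1⟩

theorem orderNorm_one_continuousMap (f : C(X, ℝ)) : orderNorm 1 f = ‖f‖ := by
  refine le_antisymm ?_ ?_
  · refine le_of_forall_gt_imp_ge_of_dense fun r hr => ?_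
    have h : ∀ x, |f x| ≤ r := fun x => (f.norm_coe_le_norm x).trans hr.le
    refine orderNorm_le ((norm_nonneg f).trans_lt hr) (fun x => ?_) (fun x => ?_)
    · simpa using (abs_le.1 (h x)).1
    · simpa using (abs_le.1 (h x)).2
  · refine le_of_forall_gt_imp_ge_of_dense fun r hr => ?_
    obtain ⟨h1, h2⟩ := (isOrderUnit_one_continuousMap X).mem_interval_of_orderNorm_lt hr
    refine (ContinuousMap.norm_le _ ((orderNorm_nonneg f).trans hr.le)).2 fun x => ?_
    exact abs_le.2 ⟨by simpa using h1 x, by simpa using h2 x⟩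

end OrderUnitSpace

/-! ### Hermitian elements of C⋆-algebras. -/

section CStar

/-- In the Hermitian part of a C⋆-algebra, the unit ball is full. -/
theorem norm_le_max_of_mem_hermitianCone {A : Type*} [NonUnitalCStarAlgebra A]
    {x y z : selfAdjoint A} (hxy : y - x ∈ hermitianCone A) (hyz : z - y ∈ hermitianCone A) :
    ‖y‖ ≤ max ‖x‖ ‖z‖ := by
  -- In the unitization the scalars `±M` are available as order bounds, and the embedding preserves
  -- norms and positivity.
  have hsa : ∀ a : selfAdjoint A, IsSelfAdjoint ((a : A) : Unitization ℂ A) := fun a =>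
    IsSelfAdjoint.inr ℂ a.2
  have hle : ∀ a b : selfAdjoint A, b - a ∈ hermitianCone A →
      ((a : A) : Unitization ℂ A) ≤ ((b : A) : Unitization ℂ A) := by
    rintro a b ⟨c, hc⟩
    rw [← sub_nonneg, ← Unitization.inr_sub, ← AddSubgroupClass.coe_sub, hc,
      Unitization.inr_mul, Unitization.inr_star]
    exact star_mul_self_nonneg _
  have hnorm : ∀ a : selfAdjoint A, ‖((a : A) : Unitization ℂ A)‖ = ‖a‖ := fun a =>
    Unitization.norm_inr (𝕜 := ℂ) (a : A)
  set M := max ‖x‖ ‖z‖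
  have hmono : ∀ {r s : ℝ}, r ≤ s →
      algebraMap ℝ (Unitization ℂ A) r ≤ algebraMap ℝ (Unitization ℂ A) s := fun h =>
    algebraMap_mono _ h
  have h1 : -algebraMap ℝ (Unitization ℂ A) M ≤ ((y : A) : Unitization ℂ A) := by
    refine le_trans ?_ ((hsa x).neg_algebraMap_norm_le_self.trans (hle x y hxy))
    rw [hnorm]
    exact neg_le_neg (hmono (le_max_left _ _))
  have h2 : ((y : A) : Unitization ℂ A) ≤ algebraMap ℝ (Unitization ℂ A) M := by
    refine ((hle y z hyz).trans (hsa z).le_algebraMap_norm_self).trans ?_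
    rw [hnorm]
    exact hmono (le_max_right _ _)
  rw [← hnorm]
  -- The spectrum of `y` lies in `[-M, M]` and contains `‖y‖` or `-‖y‖`.
  rcases CStarAlgebra.norm_or_neg_norm_mem_spectrum (hsa y) with h | h
  · exact (le_algebraMap_iff_spectrum_le (hsa y)).1 h2 _ h
  · have := (algebraMap_le_iff_le_spectrum (r := -M) (hsa y)).1 (by rwa [map_neg]) _ h
    linarith

variable (X : Type*) [TopologicalSpace X]

/-- The embedding of the real continuous functions into the Hermitian complex ones. -/
def realToHermitian : C(X, ℝ) →ₗ[ℝ] selfAdjoint C(X, ℂ) where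
  toFun f := ⟨⟨fun x => (f x : ℂ), by fun_prop⟩, by
    ext x; exact Complex.conj_ofReal (f x)⟩
  map_add' f g := by ext x; simp
  map_smul' c f := by ext x; simp

variable {X}

theorem realToHermitian_apply (f : C(X, ℝ)) (x : X) :
    (realToHermitian X f : C(X, ℂ)) x = f x := rfl

variable [CompactSpace X]

theorem norm_realToHermitian (f : C(X, ℝ)) : ‖realToHermitian X f‖ = ‖f‖ := by
  have h : ∀ x, ‖(realToHermitian X f : C(X, ℂ)) x‖ = ‖f x‖ := fun x => Complex.norm_real _
  refine le_antisymm ?_ ?_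
  · exact (ContinuousMap.norm_le _ (norm_nonneg _)).2 fun x => (h x).trans_le (f.norm_coe_le_norm x)
  · exact (ContinuousMap.norm_le _ (norm_nonneg _)).2 fun x =>
      (h x).symm.trans_le ((realToHermitian X f : C(X, ℂ)).norm_coe_le_norm x)

open scoped ComplexOrder in
theorem realToHermitian_mem_hermitianCone (f : C(X, ℝ)) :
    0 ≤ f ↔ realToHermitian X f ∈ hermitianCone C(X, ℂ) := by
  constructor
  · intro hf
    refine ⟨⟨fun x => (Real.sqrt (f x) : ℂ), by fun_prop⟩, ?_⟩
    have hf' : ∀ x, 0 ≤ f x := hf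
    ext x
    simp [realToHermitian_apply, ← Complex.ofReal_mul, Real.mul_self_sqrt (hf' x)]
  · rintro ⟨b, hb⟩ x
    have h : (f x : ℂ) = star (b x) * b x := congrArg (fun k : C(X, ℂ) => k x) hb
    exact Complex.zero_le_real.1 (h ▸ star_mul_self_nonneg (b x))

end CStar

end OrdRep

/-! ### The equivalences, tied together through (3) and (6). -/

theorem mainTheorem5 (E : Type u) [NormedAddCommGroup E] [NormedSpace ℝ E]
    [PartialOrder E] [IsOrderedAddMonoid E] [IsOrderedModule ℝ E]
    (hclosed : IsClosed {x : E | 0 ≤ x}) :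
    List.TFAE [
      -- (1) representation on `C(X)` with norm-preserving positive extensions
      ∃ (X : Type (max u v)) (_ : TopologicalSpace X) (_ : CompactSpace X) (_ : T2Space X)
        (W : Submodule ℝ C(X, ℝ)) (φ : E ≃ₗ[ℝ] W), IsIsometricIsomorphismCX W φ ∧
        ∀ f ∈ positiveDual E, ∃ g ∈ positiveDual C(X, ℝ),
          (∀ y : E, g (φ y : C(X, ℝ)) = f y) ∧ ‖g‖ = ‖f‖,
      -- (2) representation on `C(X)` in which positive contractive functionals are evaluations
      ∃ (X : Type (max u v)) (_ : TopologicalSpace X) (_ : CompactSpace X) (_ : T2Space X)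
        (W : Submodule ℝ C(X, ℝ)) (φ : E ≃ₗ[ℝ] W), IsIsometricIsomorphismCX W φ ∧
        ∀ f ∈ positiveDualBall E, ∃ x : X, ∀ y : E, (φ y : C(X, ℝ)) x = f y,
      -- (3) representation on `C(X)`
      ∃ (X : Type (max u v)) (_ : TopologicalSpace X) (_ : CompactSpace X) (_ : T2Space X)
        (W : Submodule ℝ C(X, ℝ)) (φ : E ≃ₗ[ℝ] W), IsIsometricIsomorphismCX W φ,
      -- (4) the unit ball is full
      ∀ a x b : E, a ≤ x → x ≤ b → ‖a‖ ≤ 1 → ‖b‖ ≤ 1 → ‖x‖ ≤ 1,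
      -- (5) every element is semi-positive or semi-negative
      ∀ x : E, SemiPositive x ∨ SemiNegative x,
      -- (6)
      ∀ x y z : E, x ≤ y → y ≤ z → ‖y‖ ≤ max ‖x‖ ‖z‖,
      -- (7) norm-additive decomposition of functionals into positive ones
      ∀ u : StrongDual ℝ E, ∃ v₁ ∈ positiveDual E, ∃ v₂ ∈ positiveDual E,
        u = v₁ - v₂ ∧ ‖u‖ = ‖v₁‖ + ‖v₂‖,
      -- (8) norming states (the zero space carries no functional of norm one)
      ∀ x₀ : E, ∃ f ∈ positiveDualBall E, (Nontrivial E → ‖f‖ = 1) ∧ |f x₀| = ‖x₀‖,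
      -- (9)
      ∀ x₀ : E, IsLUB ((fun f : StrongDual ℝ E => |f x₀|) '' positiveDualBall E) ‖x₀‖,
      -- (10) Hermitian part of a C⋆-algebra
      ∃ (A : Type (max u v)) (_ : NonUnitalCStarAlgebra A)
        (W : Submodule ℝ (selfAdjoint A)) (φ : E ≃ₗ[ℝ] W),
        IsIsometricIsomorphism (hermitianCone A) (fun a => ‖a‖) W φ,
      -- (11) Hermitian part of a commutative C⋆-algebra
      ∃ (A : Type (max u v)) (_ : NonUnitalCommCStarAlgebra A)
        (W : Submodule ℝ (selfAdjoint A)) (φ : E ≃ₗ[ℝ] W),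
        IsIsometricIsomorphism (hermitianCone A) (fun a => ‖a‖) W φ,
      -- (12) Riesz space with an M-norm
      ∃ (R : Type (max u v)) (_ : NormedAddCommGroup R) (_ : NormedSpace ℝ R) (_ : Lattice R)
        (_ : IsOrderedAddMonoid R) (_ : IsOrderedModule ℝ R)
        (P : Submodule ℝ R) (φ : E ≃ₗ[ℝ] P),
        IsMNorm R ∧ IsIsometricIsomorphism {r : R | 0 ≤ r} (fun r => ‖r‖) P φ,
      -- (13) almost Archimedean order unit space
      ∃ (F : Type (max u v)) (_ : AddCommGroup F) (_ : Module ℝ F) (_ : PartialOrder F)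
        (_ : IsOrderedAddMonoid F) (_ : IsOrderedModule ℝ F) (e : F)
        (K : Submodule ℝ F) (φ : E ≃ₗ[ℝ] K),
        IsOrderUnit e ∧ IsAlmostArchimedeanSpace F ∧
        IsIsometricIsomorphism {y : F | 0 ≤ y} (orderNorm e) K φ,
      -- (14) Archimedean order unit space
      ∃ (F : Type (max u v)) (_ : AddCommGroup F) (_ : Module ℝ F) (_ : PartialOrder F)
        (_ : IsOrderedAddMonoid F) (_ : IsOrderedModule ℝ F) (e : F)
        (K : Submodule ℝ F) (φ : E ≃ₗ[ℝ] K),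
        IsOrderUnit e ∧ IsArchimedeanSpace F ∧
        IsIsometricIsomorphism {y : F | 0 ≤ y} (orderNorm e) K φ] := by
  tfae_have 6 → 7 := fun h => exists_sub_norm_add h
  tfae_have 7 → 8 := fun h => exists_state h
  tfae_have 8 → 9 := by
    intro h x
    obtain ⟨f, hf, -, hfx⟩ := h x
    refine ⟨?_, fun b hb => hfx ▸ hb ⟨f, hf, rfl⟩⟩
    rintro _ ⟨g, hg, rfl⟩
    exact abs_apply_le_norm hg x
  tfae_have 9 → 2 := exists_representation_of_isLUB.{u, v} hclosed
  tfae_have 2 → 1 := by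
    rintro ⟨X, hX, hXc, hXt, W, φ, hφ, h⟩
    exact ⟨X, hX, hXc, hXt, W, φ, hφ, fun f hf => exists_positive_extension hφ h hf⟩
  tfae_have 1 → 3 := by
    rintro ⟨X, hX, hXc, hXt, W, φ, hφ, -⟩
    exact ⟨X, hX, hXc, hXt, W, φ, hφ⟩
  tfae_have 3 → 12 := by
    rintro ⟨X, hX, hXc, hXt, W, φ, hφ⟩
    exact ⟨C(X, ℝ), inferInstance, inferInstance, inferInstance, inferInstance, inferInstance,
      W, φ, isMNorm_continuousMap X, hφ⟩
  tfae_have 12 → 6 := by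
    rintro ⟨R, _, _, _, _, _, P, φ, hR, hφ⟩
    exact hφ.norm_le_max fun x y z hxy hyz =>
      hR.norm_le_max (sub_nonneg.1 hxy) (sub_nonneg.1 hyz)
  tfae_have 6 → 4 := fun h a x b hax hxb ha hb => (h a x b hax hxb).trans (max_le ha hb)
  tfae_have 4 → 6 := fun h x y z hxy hyz => norm_le_max_of_full_ball h hxy hyz
  tfae_have 6 → 5 := by
    intro h x
    by_contra! hx
    simp only [SemiPositive, SemiNegative] at hx
    push Not at hx
    obtain ⟨⟨l, hl, hxl⟩, m, hm, hxm⟩ := hx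
    -- Failure of both alternatives places `x` between two vectors of strictly smaller norm.
    exact absurd (h (x - m) x (x + l) (sub_le_self x hm) (le_add_of_nonneg_right hl))
      (not_le.2 (max_lt hxm hxl))
  tfae_have 5 → 6 := by
    intro h x y z hxy hyz
    rcases h y with hy | hy
    · refine le_max_of_le_right ?_
      simpa using hy (z - y) (sub_nonneg.2 hyz)
    · refine le_max_of_le_left ?_
      simpa using hy (y - x) (sub_nonneg.2 hxy)
  tfae_have 3 → 14 := by
    rintro ⟨X, hX, hXc, hXt, W, φ, hφ⟩
    exact ⟨C(X, ℝ), inferInstance, inferInstance, inferInstance, inferInstance, inferInstance,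
      1, W, φ, isOrderUnit_one_continuousMap X, isArchimedeanSpace_continuousMap X,
      hφ.bipositive, fun y => (orderNorm_one_continuousMap X _).trans (hφ.isometric y)⟩
  tfae_have 14 → 13 := by
    rintro ⟨F, hF₁, hF₂, hF₃, hF₄, hF₅, e, K, φ, he, hF, hφ⟩
    exact ⟨F, hF₁, hF₂, hF₃, hF₄, hF₅, e, K, φ, he, hF.isAlmostArchimedeanSpace, hφ⟩
  tfae_have 13 → 6 := by
    rintro ⟨F, _, _, _, _, _, e, K, φ, he, -, hφ⟩
    exact hφ.norm_le_max fun x y z hxy hyz =>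
      he.orderNorm_le_max (sub_nonneg.1 hxy) (sub_nonneg.1 hyz)
  tfae_have 3 → 11 := by
    rintro ⟨X, hX, hXc, hXt, W, φ, hφ⟩
    exact ⟨C(X, ℂ), inferInstance, IsIsometricIsomorphism.exists_comp hφ (realToHermitian X)
      realToHermitian_mem_hermitianCone norm_realToHermitian⟩
  tfae_have 11 → 10 := by
    rintro ⟨A, hA, W, φ, hφ⟩
    exact ⟨A, inferInstance, W, φ, hφ⟩
  tfae_have 10 → 6 := by
    rintro ⟨A, _, W, φ, hφ⟩
    exact hφ.norm_le_max fun x y z => norm_le_max_of_mem_hermitianCone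
  tfae_finish
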